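/- All rings are associative with identity. A ring $A$ is called right invariant if every right ideal of $A$ is a two-sided ideal; "ideal" means two-sided ideal, and an ideal $P\neq A$ is prime if for all ideals $I,J$ of $A$ the inclusion $IJ\subseteq P$ implies $I\subseteq P$ or $J\subseteq P$. A right module is finite-dimensional if it contains no direct sum of infinitely many nonzero submodules, and a ring $R$ is right finite-dimensional if the right module $R_R$ is. The Krull dimension $\operatorname{Kdim} M$ of a module $M$ (which need not exist) is defined by transfinite recursion: $\operatorname{Kdim} M=-1$ if and only if $M=0$; for an ordinal $\alpha\ge 0$, $\operatorname{Kdim} M=\alpha$ if $\operatorname{Kdim} M\neq\beta$ for all $\beta<\alpha$ and every infinite properly descending chain $M_1>M_2>\dots$ of submodules of $M$ has a factor $M_n/M_{n+1}$ with $\operatorname{Kdim}(M_n/M_{n+1})<\alpha$. A ring $A$ has right Krull dimension if the right module $A_A$ has Krull dimension. **Lemma.** For a right invariant ring $A$, the following conditions are equivalent. 1) The ring $A$ has right Krull dimension. 2) The ring $A$ satisfies the maximum condition on prime ideals (every nonempty set of prime ideals of $A$ has a maximal element), all factor rings $A/I$ of $A$ by ideals $I$ are right finite-dimensional, and for every nonzero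 proper ideal $B$ of $A$ there exist an integer $n\ge 1$ and prime ideals $P_1,\ldots,P_n$ of $A$ such that $$P_1\cdots P_n\subseteq B\subseteq P_1\cap\ldots\cap P_n.$$ -/

import Mathlib

universe u v

/-- `KdimEq R α M`: the `R`-module `M` has Krull dimension equal to `α` (in the sense of
Gabriel--Rentschler and Gordon--Robson), where `α` is `-1` (written `⊥`) or an ordinal.
* `Kdim M = -1` iff `M` is zero;
* for an ordinal `α`, `Kdim M = α` iff `Kdim M` is not equal to any `β < α` and every infinite
  properly descending chain `N 0 > N 1 > ⋯` of submodules of `M` has a factor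
  `N n / N (n + 1)` whose Krull dimension is some `β < α`.

For `α = 0` the only modules of smaller Krull dimension are zero, so that the second clause says
that `M` is nonzero and that there is no infinite properly descending chain, i.e. that `M` is a
nonzero Artinian module. -/
def KdimEq (R : Type u) [Ring R] (α : WithBot Ordinal.{v})
    (M : Type v) [AddCommGroup M] [Module R M] : Prop :=
  (α = ⊥ ∧ Subsingleton M) ∨
  (α ≠ ⊥ ∧
    (∀ β : WithBot Ordinal.{v}, β < α → ¬ KdimEq R β M) ∧
    ∀ N : ℕ → Submodule R M, StrictAnti N →
      ∃ n : ℕ, ∃ β : WithBot Ordinal.{v}, ∃ _ : β < α,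
        KdimEq R β (N n ⧸ (N (n + 1)).submoduleOf (N n)))
termination_by WellFounded.wrap (wellFounded_lt (α := WithBot Ordinal.{v})) α
decreasing_by all_goals assumption

/-- The `R`-module `M` has Krull dimension. -/
def HasKdim (R : Type u) [Ring R] (M : Type v) [AddCommGroup M] [Module R M] : Prop :=
  ∃ α : WithBot Ordinal.{v}, KdimEq R α M

/-- The module `M` is finite-dimensional: it does not contain a direct sum of infinitely many
nonzero submodules. -/
def IsFiniteDimensionalModule (R : Type u) [Ring R] (M : Type v) [AddCommGroup M] [Module R M] :
    Prop :=
  ¬ ∃ N : ℕ → Submodule R M, (∀ i, N i ≠ ⊥) ∧ iSupIndep N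

/-- The ring `A` has right Krull dimension, i.e. the right module `A_A` has Krull dimension.
Right `A`-modules are modules over the opposite ring `Aᵐᵒᵖ`. -/
def HasRightKdim (A : Type u) [Ring A] : Prop :=
  HasKdim Aᵐᵒᵖ A

/-- The ring `A` is right finite-dimensional. -/
def IsRightFiniteDimensional (A : Type u) [Ring A] : Prop :=
  IsFiniteDimensionalModule Aᵐᵒᵖ A

/-- The ring `A` is right invariant: every right ideal of `A` is a (two-sided) ideal. -/
def IsRightInvariant (A : Type u) [Ring A] : Prop :=
  ∀ I : Submodule Aᵐᵒᵖ A, ∀ a x : A, x ∈ I → a * x ∈ I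

/-- `P` is a prime ideal of the (noncommutative) ring `A`: a proper two-sided ideal such that
`I * J ⊆ P` implies `I ⊆ P` or `J ⊆ P` for all two-sided ideals `I` and `J`. -/
def IsPrimeTwoSided {A : Type u} [Ring A] (P : Ideal A) : Prop :=
  P.IsTwoSided ∧ P ≠ ⊤ ∧
    ∀ I J : Ideal A, I.IsTwoSided → J.IsTwoSided → I * J ≤ P → I ≤ P ∨ J ≤ P

/-- The maximum condition on prime ideals: every nonempty set of prime ideals of `A` has a
maximal element. -/
def HasMaxConditionOnPrimes (A : Type u) [Ring A] : Prop :=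
  ∀ S : Set (Ideal A), S.Nonempty → (∀ P ∈ S, IsPrimeTwoSided P) →
    ∃ P, Maximal (fun Q => Q ∈ S) P

/-- The product `P 0 * P 1 * ⋯ * P (n - 1)` of two-sided ideals. -/
def idealProd {A : Type u} [Ring A] {n : ℕ} (P : Fin n → Ideal A) : Ideal A :=
  (List.ofFn P).foldr (fun I J => I * J) ⊤

/-!
# Right invariant rings with right Krull dimension

The existence of Krull dimension is a property of the lattice of submodules alone. A module `M` has
no Krull dimension if and only if there is a family of intervals of submodules, containing
`[0, M]`, each member of which contains an infinite properly descending chain whose successive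
intervals are in the family again (`NoDeviation`, `hasKdim_iff`). This coinductive form replaces
ordinals throughout. In a right invariant ring every right ideal is two-sided, prime ideals are
completely prime, and everything takes place in the modular lattice of right ideals.

*Condition 2 implies condition 1.* Lemonnier's criterion says that `M` has Krull dimension as soon
as all its factor modules are finite-dimensional and every nonzero subquotient contains a nonzero
submodule with Krull dimension (`NoDeviation.exists_hasIndepSeqOver`). If `B` contains a product of
primes `P₁ ⋯ Pₙ` above `B`, every nonzero subquotient of `A / B` contains a nonzero image of some
`A / Pᵢ`; so `A / B` has Krull dimension if all `A / Pᵢ` do. Noetherian induction on primes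
then does the rest, because a descending chain that is infinite consists of ideals strictly
above its lower bound.

*Condition 1 implies condition 2.* An infinite direct sum, or primes without a maximal element,
would produce a family of intervals as above. The products of primes are the main point. If `A`
is right finite-dimensional modulo all ideals and `K ⊇ I` contains a product of primes, while each
element of `K` is annihilated modulo `I` by a product of primes, then `I` contains a product of
primes (`ContainsPrimeProduct.of_elementwise`). Consequently the right ideals above which all right
ideals contain products of primes above themselves form a Gabriel filter. If some right ideal
contained no product of primes above it, the existence of Krull dimension would provide such an
`I` for which the right ideals above `I` that are closed for the corresponding torsion theory
satisfy the descending chain condition. The argument of Hopkins' theorem then yields a product of primes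
inside the closure of `I` (`ClosedDCC.containsPrimeProduct`), and therefore one inside `I`.
-/

/-! ### Intervals without deviation in a lattice -/

section Lattice

variable {α β : Type*}

/-- The interval `[a, b]` does not have deviation (Krull dimension as a poset): there is a family
`B` of intervals, containing `[a, b]`, each member of which contains an infinite properly descending
chain all of whose successive intervals belong to `B` again. For the lattice of submodules of a
module this is the failure of Krull dimension to exist, expressed coinductively and without
ordinals. -/
def NoDeviation [Preorder α] (a b : α) : Prop :=
  ∃ B : α → α → Prop, B a b ∧ ∀ x y, B x y →
    ∃ N : ℕ → α, StrictAnti N ∧ (∀ n, x ≤ N n ∧ N n ≤ y) ∧ ∀ n, B (N (n + 1)) (N n)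

theorem NoDeviation.exists_chain [Preorder α] {a b : α} (h : NoDeviation a b) :
    ∃ N : ℕ → α, StrictAnti N ∧ (∀ n, a ≤ N n ∧ N n ≤ b) ∧ ∀ n, NoDeviation (N (n + 1)) (N n) := by
  obtain ⟨B, hab, hB⟩ := h
  obtain ⟨N, h1, h2, h3⟩ := hB a b hab
  exact ⟨N, h1, h2, fun n => ⟨B, h3 n, hB⟩⟩

theorem NoDeviation.of_coinduction [Preorder α] (B : α → α → Prop)
    (hB : ∀ x y, B x y →
      ∃ N : ℕ → α, StrictAnti N ∧ (∀ n, x ≤ N n ∧ N n ≤ y) ∧ ∀ n, B (N (n + 1)) (N n))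
    {a b : α} (hab : B a b) : NoDeviation a b := ⟨B, hab, hB⟩

theorem NoDeviation.le [Preorder α] {a b : α} (h : NoDeviation a b) : a ≤ b := by
  obtain ⟨N, -, h2, -⟩ := h.exists_chain
  exact (h2 0).1.trans (h2 0).2

/-- `NoDeviation` is inherited along a map that is strictly monotone on the interval. -/
theorem NoDeviation.map [PartialOrder α] [Preorder β] {a b : α} {f : α → β}
    (hf : StrictMonoOn f (Set.Icc a b)) (h : NoDeviation a b) {c d : β} (hc : c ≤ f a)
    (hd : f b ≤ d) : NoDeviation c d := by
  refine NoDeviation.of_coinduction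
    (fun x y => ∃ a' b', a ≤ a' ∧ b' ≤ b ∧ NoDeviation a' b' ∧ x ≤ f a' ∧ f b' ≤ y) ?_
    ⟨a, b, le_rfl, le_rfl, h, hc, hd⟩
  rintro x y ⟨a', b', ha, hb, h', hx, hy⟩
  obtain ⟨N, h1, h2, h3⟩ := h'.exists_chain
  have hmem : ∀ n, N n ∈ Set.Icc a b := fun n => ⟨ha.trans (h2 n).1, (h2 n).2.trans hb⟩
  have hab := h'.le
  refine ⟨fun n => f (N n), fun m n hmn => hf (hmem n) (hmem m) (h1 hmn), fun n => ⟨?_, ?_⟩,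
    fun n => ⟨N (n + 1), N n, (hmem _).1, (hmem _).2, h3 n, le_rfl, le_rfl⟩⟩
  · exact hx.trans (hf.monotoneOn ⟨ha, hab.trans hb⟩ (hmem n) (h2 n).1)
  · exact (hf.monotoneOn (hmem n) ⟨ha.trans hab, hb⟩ (h2 n).2).trans hy

theorem NoDeviation.mono [PartialOrder α] {a b c d : α} (h : NoDeviation a b) (hc : c ≤ a)
    (hd : b ≤ d) : NoDeviation c d :=
  h.map (f := id) (fun _ _ _ _ hxy => hxy) hc hd

/-- An infinite independent family of nonzero elements: intervals between the suprema of two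
subfamilies that differ by infinitely many members can be refined indefinitely. -/
theorem noDeviation_of_iSupIndep [CompleteLattice α] {t : ℕ → α} (ht : iSupIndep t)
    (h0 : ∀ i, t i ≠ ⊥) : NoDeviation (⊥ : α) ⊤ := by
  have hlt : ∀ S T : Set ℕ, S ⊆ T → ∀ j ∈ T, j ∉ S → (⨆ i ∈ S, t i) < ⨆ i ∈ T, t i := by
    intro S T hST j hj hjS
    refine lt_of_le_not_ge (biSup_mono hST) fun hle => h0 j ?_
    have h1 : t j ≤ ⨆ i ∈ S, t i := (le_biSup t hj).trans hle
    have h2 : (⨆ i ∈ S, t i) ≤ ⨆ (i) (_ : i ≠ j), t i :=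
      biSup_mono fun i hi => by rintro rfl; exact hjS hi
    exact le_bot_iff.1 (ht j le_rfl (h1.trans h2))
  refine NoDeviation.of_coinduction
    (fun x y => ∃ S T : Set ℕ, S ⊆ T ∧ (T \ S).Infinite ∧ x ≤ (⨆ i ∈ S, t i) ∧
      (⨆ i ∈ T, t i) ≤ y) ?_
    ⟨∅, Set.univ, Set.empty_subset _, by simpa using Set.infinite_univ, by simp, le_top⟩
  rintro x y ⟨S, T, hST, hinf, hx, hy⟩
  let e := hinf.natEmbedding
  let U : ℕ → Set ℕ := fun n => S ∪ {k | ∃ i j, n ≤ i ∧ k = e (Nat.pair i j)}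
  have hUT : ∀ n, U n ⊆ T := by
    rintro n k (hk | ⟨i, j, -, rfl⟩)
    · exact hST hk
    · exact (e (Nat.pair i j)).2.1
  have hmono : ∀ n, U (n + 1) ⊆ U n := by
    rintro n k (hk | ⟨i, j, hi, rfl⟩)
    · exact Or.inl hk
    · exact Or.inr ⟨i, j, by omega, rfl⟩
  have hin : ∀ n j, (e (Nat.pair n j) : ℕ) ∈ U n := fun n j => Or.inr ⟨n, j, le_rfl, rfl⟩
  have hnot : ∀ n j, (e (Nat.pair n j) : ℕ) ∉ U (n + 1) := by
    rintro n j (h | ⟨i, k, hi, h⟩)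
    · exact (e (Nat.pair n j)).2.2 h
    · have := e.injective (Subtype.ext h)
      have := (Nat.pair_eq_pair.1 this).1
      omega
  refine ⟨fun n => ⨆ i ∈ U n, t i, strictAnti_nat_of_succ_lt fun n =>
    hlt _ _ (hmono n) _ (hin n 0) (hnot n 0), fun n => ⟨?_, ?_⟩, fun n =>
    ⟨U (n + 1), U n, hmono n, ?_, le_rfl, le_rfl⟩⟩
  · exact hx.trans (biSup_mono Set.subset_union_left)
  · exact le_trans (biSup_mono (hUT n)) hy
  · refine Set.infinite_of_injective_forall_mem (f := fun j => (e (Nat.pair n j) : ℕ)) ?_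
      fun j => ⟨hin n j, hnot n j⟩
    intro j k hjk
    exact (Nat.pair_eq_pair.1 (e.injective (Subtype.ext hjk))).2

/-- A sequence of elements `E n` that is independent modulo `L`: the `E m` with `n < m`, together
with `L`, lie below `b (n + 1)`, which meets `E n` inside `L`. -/
def HasIndepSeqOver [Lattice α] (L : α) : Prop :=
  ∃ E b : ℕ → α, Antitone b ∧ (∀ n, L ≤ b n) ∧ (∀ n, E n ≤ b n) ∧ (∀ n, ¬ E n ≤ b (n + 1)) ∧
    ∀ n, E n ⊓ b (n + 1) ≤ L

/-- Shrinking intervals `[a, b]`, each time splitting off some `E ≤ b` that leaves the new interval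
`[a', b']` in the sense that `E ⊓ b' ≤ a'`, gives an independent sequence modulo the supremum of
the lower ends. -/
theorem exists_hasIndepSeqOver [CompleteLattice α] (S : Set (α × α)) (hne : S.Nonempty)
    (hle : ∀ p ∈ S, p.1 ≤ p.2)
    (hstep : ∀ p ∈ S, ∃ E, ∃ q ∈ S, p.1 ≤ q.1 ∧ q.2 ≤ p.2 ∧ E ≤ p.2 ∧ ¬ E ≤ q.2 ∧
      E ⊓ q.2 ≤ q.1) :
    ∃ L : α, HasIndepSeqOver L := by
  choose! E q hqS h1 h2 h3 h4 h5 using hstep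
  obtain ⟨p0, hp0⟩ := hne
  let s : ℕ → α × α := fun n => q^[n] p0
  have hs : ∀ n, s (n + 1) = q (s n) := fun n => Function.iterate_succ_apply' q n p0
  have hS : ∀ n, s n ∈ S := by
    intro n
    induction n with
    | zero => exact hp0
    | succ n ih => rw [hs]; exact hqS _ ih
  have ha : Monotone fun n => (s n).1 :=
    monotone_nat_of_le_succ fun n => by simp only [hs]; exact h1 _ (hS n)
  have hb : Antitone fun n => (s n).2 :=
    antitone_nat_of_succ_le fun n => by simp only [hs]; exact h2 _ (hS n)
  refine ⟨⨆ n, (s n).1, fun n => E (s n), fun n => (s n).2, hb, fun n => iSup_le fun m => ?_,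
    fun n => h3 _ (hS n), fun n => ?_, fun n => ?_⟩
  · exact (ha (le_max_left m n)).trans ((hle _ (hS _)).trans (hb (le_max_right m n)))
  · simp only [hs]; exact h4 _ (hS n)
  · refine le_trans ?_ (le_iSup (fun n => (s n).1) (n + 1))
    simp only [hs]; exact h5 _ (hS n)

/-- If the trace on `E` of an interval without deviation has deviation, then `E` does not see some
subinterval without deviation. -/
theorem NoDeviation.exists_inf_le [Lattice α] {a b E : α} (h : NoDeviation a b)
    (hE : ¬ NoDeviation (E ⊓ a) (E ⊓ b)) :
    ∃ a' b', a ≤ a' ∧ b' ≤ b ∧ NoDeviation a' b' ∧ E ⊓ b' ≤ a' := by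
  by_contra! hcon
  refine hE (NoDeviation.of_coinduction
    (fun x y => ∃ a' b', a ≤ a' ∧ b' ≤ b ∧ NoDeviation a' b' ∧ x = E ⊓ a' ∧ y = E ⊓ b') ?_
    ⟨a, b, le_rfl, le_rfl, h, rfl, rfl⟩)
  rintro _ _ ⟨a', b', ha, hb, h', rfl, rfl⟩
  obtain ⟨N, h1, h2, h3⟩ := h'.exists_chain
  refine ⟨fun n => E ⊓ N n, strictAnti_nat_of_succ_lt fun n => ?_, fun n =>
    ⟨inf_le_inf_left _ (h2 n).1, inf_le_inf_left _ (h2 n).2⟩, fun n =>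
    ⟨N (n + 1), N n, ha.trans (h2 _).1, (h2 _).2.trans hb, h3 n, rfl, rfl⟩⟩
  refine lt_of_le_not_ge (inf_le_inf_left _ (h1 (Nat.lt_succ_self n)).le) fun hle => ?_
  exact hcon _ _ (ha.trans (h2 _).1) ((h2 _).2.trans hb) (h3 n) (hle.trans inf_le_right)

/-- Lemonnier's criterion: if every proper interval above `a` starts with a nontrivial interval
that has deviation, then an interval `[a, b]` without deviation yields an infinite independent
sequence over some element. -/
theorem NoDeviation.exists_hasIndepSeqOver [CompleteLattice α] {a b : α} (h : NoDeviation a b)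
    (hsub : ∀ x y, a ≤ x → x < y → y ≤ b → ∃ E, x ≤ E ∧ E ≤ y ∧ ¬ E ≤ x ∧ ¬ NoDeviation x E) :
    ∃ L : α, HasIndepSeqOver L := by
  refine _root_.exists_hasIndepSeqOver {p : α × α | a ≤ p.1 ∧ p.2 ≤ b ∧ NoDeviation p.1 p.2}
    ⟨(a, b), le_rfl, le_rfl, h⟩ (fun p hp => hp.2.2.le) ?_
  rintro ⟨x, y⟩ ⟨hx, hy, hxy⟩
  obtain ⟨N, h1, h2, h3⟩ := hxy.exists_chain
  obtain ⟨E, hE1, hE2, hE3, hE4⟩ := hsub (⨅ n, N n) (N 0) (hx.trans (le_iInf fun n => (h2 n).1))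
    ((iInf_le N 1).trans_lt (h1 Nat.zero_lt_one)) ((h2 0).2.trans hy)
  obtain ⟨n, hn⟩ : ∃ n, ¬ E ≤ N n := by
    by_contra! hcon
    exact hE3 (le_iInf hcon)
  obtain ⟨a', b', ha', hb', hab', hEab⟩ := (h3 n).exists_inf_le (E := E) fun hbad =>
    hE4 (hbad.mono (le_inf hE1 (iInf_le N _)) inf_le_left)
  refine ⟨E, (a', b'), ⟨hx.trans ((h2 _).1.trans ha'), hb'.trans ((h2 n).2.trans hy), hab'⟩,
    (h2 _).1.trans ha', hb'.trans (h2 n).2, hE2.trans (h2 0).2, fun hle => hn (hle.trans hb'), hEab⟩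

end Lattice

/-! ### Krull dimension and deviation -/

section Kdim

variable {R : Type u} [Ring R]

theorem KdimEq_iff (α : WithBot Ordinal.{v}) (M : Type v) [AddCommGroup M] [Module R M] :
    KdimEq R α M ↔ (α = ⊥ ∧ Subsingleton M) ∨
      (α ≠ ⊥ ∧ (∀ β : WithBot Ordinal.{v}, β < α → ¬ KdimEq R β M) ∧
        ∀ N : ℕ → Submodule R M, StrictAnti N →
          ∃ n : ℕ, ∃ β : WithBot Ordinal.{v}, ∃ _ : β < α,
            KdimEq R β (N n ⧸ (N (n + 1)).submoduleOf (N n))) := by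
  rw [KdimEq]

/-- The submodules of a subquotient `y ⧸ x` embed into the interval `[x, y]`. -/
theorem exists_strictMono_of_subquotient {M : Type v} [AddCommGroup M] [Module R M]
    {x y : Submodule R M} (hxy : x ≤ y) :
    ∃ f : Submodule R (y ⧸ x.submoduleOf y) → Submodule R M,
      StrictMono f ∧ ∀ z, x ≤ f z ∧ f z ≤ y := by
  refine ⟨fun z => (z.comap (x.submoduleOf y).mkQ).map y.subtype, ?_, fun z => ⟨?_, ?_⟩⟩
  · refine (Submodule.map_strictMono_of_injective y.injective_subtype).comp ?_
    exact Monotone.strictMono_of_injective (fun _ _ h => Submodule.comap_mono h)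
      (Submodule.comap_injective_of_surjective (Submodule.mkQ_surjective _))
  · intro m hm
    refine ⟨⟨m, hxy hm⟩, ?_, rfl⟩
    have h0 : (x.submoduleOf y).mkQ ⟨m, hxy hm⟩ = 0 := (Submodule.Quotient.mk_eq_zero _).2 hm
    change (x.submoduleOf y).mkQ ⟨m, hxy hm⟩ ∈ z
    rw [h0]
    exact z.zero_mem
  · exact Submodule.map_subtype_le _ _

/-- The interval `[x, y]` embeds into the submodules of the subquotient `y ⧸ x`. -/
theorem strictMonoOn_toSubquotient {M : Type v} [AddCommGroup M] [Module R M]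
    (x y : Submodule R M) :
    StrictMonoOn (fun z : Submodule R M => (z.submoduleOf y).map (x.submoduleOf y).mkQ)
      (Set.Icc x y) := by
  rintro z ⟨hz, hzy⟩ w ⟨hw, hwy⟩ hzw
  refine lt_of_le_not_ge (Submodule.map_mono (Submodule.comap_mono hzw.le)) fun hle => ?_
  refine hzw.not_ge fun m hm => ?_
  obtain ⟨k, hk, hkm⟩ := hle ⟨⟨m, hwy hm⟩, hm, rfl⟩
  have h1 := (Submodule.Quotient.eq _).1 hkm
  have h2 : (k : M) - m ∈ x := h1
  have h3 : (k : M) ∈ z := hk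
  simpa using z.sub_mem h3 (hz h2)

/-- The lattice of submodules of a module with Krull dimension has deviation. -/
theorem KdimEq.not_noDeviation {α : WithBot Ordinal.{v}} :
    ∀ (M : Type v) [AddCommGroup M] [Module R M], KdimEq R α M →
      ¬ NoDeviation (⊥ : Submodule R M) ⊤ := by
  induction α using WellFoundedLT.induction with
  | ind α ih =>
    intro M _ _ h hbad
    obtain ⟨N, h1, -, h3⟩ := hbad.exists_chain
    rw [KdimEq_iff] at h
    rcases h with ⟨-, hM⟩ | ⟨-, -, h⟩
    · exact (h1 Nat.zero_lt_one).ne (Subsingleton.elim _ _)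
    · obtain ⟨n, β, hβ, hK⟩ := h N h1
      exact ih β hβ _ hK ((h3 n).map (strictMonoOn_toSubquotient _ _) bot_le le_top)

/-- A module without Krull dimension has a descending chain all of whose factors are without
Krull dimension: otherwise the supremum of the Krull dimensions of its subquotients would bound
its Krull dimension. -/
theorem exists_chain_of_not_hasKdim {M : Type v} [AddCommGroup M] [Module R M]
    (h : ¬ HasKdim R M) : ∃ N : ℕ → Submodule R M, StrictAnti N ∧
      ∀ n, ¬ HasKdim R (N n ⧸ (N (n + 1)).submoduleOf (N n)) := by
  classical
  by_contra! hcon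
  let κ : Submodule R M × Submodule R M → WithBot Ordinal.{v} := fun p =>
    if hp : HasKdim R (p.2 ⧸ p.1.submoduleOf p.2) then hp.choose else ⊥
  have hκ : ∀ x y : Submodule R M, HasKdim R (y ⧸ x.submoduleOf y) →
      KdimEq R (κ (x, y)) (y ⧸ x.submoduleOf y) := by
    intro x y hxy
    simp only [κ, dif_pos hxy]
    exact hxy.choose_spec
  obtain ⟨b, hb⟩ : ∃ b : Ordinal.{v}, ∀ p, κ p < b := by
    have : BddAbove (Set.range fun p => (κ p).unbotD 0) := Ordinal.bddAbove_of_small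
    obtain ⟨c, hc⟩ := this
    refine ⟨Order.succ c, fun p => ?_⟩
    have hcp : (κ p).unbotD 0 ≤ c := hc ⟨p, rfl⟩
    rcases hp : κ p with _ | o
    · exact WithBot.bot_lt_coe _
    · rw [hp] at hcp
      exact WithBot.coe_lt_coe.2 (Order.lt_succ_of_le hcp)
  refine h ⟨b, (KdimEq_iff _ _).2 (Or.inr ⟨WithBot.coe_ne_bot, fun β _ hβ => h ⟨β, hβ⟩, ?_⟩)⟩
  intro N hN
  obtain ⟨n, hn⟩ := hcon N hN
  exact ⟨n, _, hb _, hκ _ _ hn⟩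

theorem hasKdim_iff (M : Type v) [AddCommGroup M] [Module R M] :
    HasKdim R M ↔ ¬ NoDeviation (⊥ : Submodule R M) ⊤ := by
  refine ⟨fun ⟨α, h⟩ => h.not_noDeviation M, fun h => ?_⟩
  by_contra hM
  refine h (NoDeviation.of_coinduction
    (fun x y => ∃ (M' : Type v) (_ : AddCommGroup M') (_ : Module R M'), ¬ HasKdim R M' ∧
      ∃ f : Submodule R M' → Submodule R M, StrictMono f ∧ ∀ z, x ≤ f z ∧ f z ≤ y) ?_
    ⟨M, _, _, hM, id, strictMono_id, fun _ => ⟨bot_le, le_top⟩⟩)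
  rintro x y ⟨M', _, _, hM', f, hf, hxy⟩
  obtain ⟨N, hN, hN'⟩ := exists_chain_of_not_hasKdim hM'
  refine ⟨fun n => f (N n), fun m n hmn => hf (hN hmn), fun n => hxy _, fun n => ?_⟩
  obtain ⟨g, hg, hg'⟩ := exists_strictMono_of_subquotient (hN (Nat.lt_succ_self n)).le
  exact ⟨_, _, _, hN' n, fun z => f (g z), hf.comp hg, fun z =>
    ⟨hf.monotone (hg' z).1, hf.monotone (hg' z).2⟩⟩

end Kdim

/-! ### Right ideals of a right invariant ring and products of primes -/

section RightIdeals

variable {A : Type u} [Ring A]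

/-- Right ideals of `A`, as submodules of the right module `A_A`. -/
abbrev RightIdeal (A : Type u) [Ring A] := Submodule Aᵐᵒᵖ A

theorem RightIdeal.mul_mem (I : RightIdeal A) {x : A} (hx : x ∈ I) (a : A) : x * a ∈ I :=
  I.smul_mem (MulOpposite.op a) hx

/-- Left multiplication by `t`, an endomorphism of the right module `A_A`. -/
def leftMul (t : A) : A →ₗ[Aᵐᵒᵖ] A where
  toFun x := t * x
  map_add' := mul_add t
  map_smul' r x := by simp [MulOpposite.smul_eq_mul_unop, mul_assoc]

@[simp] theorem leftMul_apply (t x : A) : leftMul t x = t * x := rfl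

/-- The right ideal `(I : t) = {x | t * x ∈ I}`. -/
abbrev RightIdeal.colon (I : RightIdeal A) (t : A) : RightIdeal A := I.comap (leftMul t)

theorem RightIdeal.mem_colon {I : RightIdeal A} {t x : A} : x ∈ I.colon t ↔ t * x ∈ I := Iff.rfl

theorem RightIdeal.colon_mul (I : RightIdeal A) (t s : A) :
    I.colon (t * s) = (I.colon t).colon s := by
  ext x
  simp [mul_assoc]

theorem RightIdeal.le_colon (hA : IsRightInvariant A) (I : RightIdeal A) (t : A) :
    I ≤ I.colon t := fun _ hx => hA I t _ hx

theorem RightIdeal.colon_eq_top {I : RightIdeal A} {t : A} (ht : t ∈ I) : I.colon t = ⊤ :=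
  eq_top_iff.2 fun x _ => I.mul_mem ht x

/-- The principal right ideal `t A`. -/
abbrev principal (t : A) : RightIdeal A := (⊤ : RightIdeal A).map (leftMul t)

theorem self_mem_principal (t : A) : t ∈ principal t := ⟨1, trivial, mul_one t⟩

theorem mem_principal {t x : A} : x ∈ principal t ↔ ∃ a, t * a = x := by simp

theorem principal_le {I : RightIdeal A} {t : A} : principal t ≤ I ↔ t ∈ I := by
  refine ⟨fun h => h (self_mem_principal t), ?_⟩
  rintro ht _ ⟨a, -, rfl⟩
  exact I.mul_mem ht a

theorem RightIdeal.eq_top_of_one_mem {I : RightIdeal A} (h : (1 : A) ∈ I) : I = ⊤ :=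
  eq_top_iff.2 fun x _ => by simpa using I.mul_mem h x

theorem mem_of_leftMul_mem_sup {X Y J : RightIdeal A} {t s : A} (hX : X ≤ Y)
    (hJ : J.colon t ≤ Y) (h : t * s ∈ X.map (leftMul t) ⊔ J) : s ∈ Y := by
  obtain ⟨_, ⟨r, hr, rfl⟩, j, hj, hst⟩ := Submodule.mem_sup.1 h
  have h1 : s - r ∈ J.colon t := by
    rw [RightIdeal.mem_colon, mul_sub]
    have : t * s - t * r = j := by rw [sub_eq_iff_eq_add']; exact hst.symm
    rwa [this]
  simpa using add_mem (hJ h1) (hX hr)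

/-- The product of two right ideals: the right ideal generated by the products of elements. -/
def rmul (I J : RightIdeal A) : RightIdeal A :=
  Submodule.span Aᵐᵒᵖ {x | ∃ i ∈ I, ∃ j ∈ J, i * j = x}

theorem rmul_le {I J K : RightIdeal A} : rmul I J ≤ K ↔ ∀ i ∈ I, ∀ j ∈ J, i * j ∈ K := by
  rw [rmul, Submodule.span_le]
  refine ⟨fun h i hi j hj => h ⟨i, hi, j, hj, rfl⟩, ?_⟩
  rintro h _ ⟨i, hi, j, hj, rfl⟩
  exact h i hi j hj

theorem mul_mem_rmul {I J : RightIdeal A} {i j : A} (hi : i ∈ I) (hj : j ∈ J) :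
    i * j ∈ rmul I J := rmul_le.1 le_rfl i hi j hj

theorem rmul_mono {I I' J J' : RightIdeal A} (h : I ≤ I') (h' : J ≤ J') :
    rmul I J ≤ rmul I' J' := rmul_le.2 fun _ hi _ hj => mul_mem_rmul (h hi) (h' hj)

theorem rmul_le_left {I J : RightIdeal A} : rmul I J ≤ I :=
  rmul_le.2 fun _ hi j _ => I.mul_mem hi j

theorem rmul_le_right (hA : IsRightInvariant A) {I J : RightIdeal A} : rmul I J ≤ J :=
  rmul_le.2 fun i _ j hj => hA J i j hj

theorem le_rmul_top {I : RightIdeal A} : I ≤ rmul I ⊤ := fun x hx => by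
  simpa using mul_mem_rmul hx (Submodule.mem_top (x := (1 : A)))

theorem rmul_assoc_le (hA : IsRightInvariant A) {I J K : RightIdeal A} :
    rmul (rmul I J) K ≤ rmul I (rmul J K) := by
  refine rmul_le.2 fun x hx => ?_
  refine Submodule.span_induction (p := fun x _ => ∀ k ∈ K, x * k ∈ rmul I (rmul J K))
    ?_ ?_ ?_ ?_ hx
  · rintro _ ⟨i, hi, j, hj, rfl⟩ k hk
    rw [mul_assoc]
    exact mul_mem_rmul hi (mul_mem_rmul hj hk)
  · intro k _
    simp
  · intro x y _ _ hx hy k hk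
    rw [add_mul]
    exact add_mem (hx k hk) (hy k hk)
  · intro a x _ hx k hk
    rw [MulOpposite.smul_eq_mul_unop, mul_assoc]
    exact hx _ (hA K _ _ hk)

theorem le_rmul_assoc {I J K : RightIdeal A} : rmul I (rmul J K) ≤ rmul (rmul I J) K := by
  refine rmul_le.2 fun i hi x hx => ?_
  refine Submodule.span_induction (p := fun x _ => i * x ∈ rmul (rmul I J) K) ?_ ?_ ?_ ?_ hx
  · rintro _ ⟨j, hj, k, hk, rfl⟩
    rw [← mul_assoc]
    exact mul_mem_rmul (mul_mem_rmul hi hj) hk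
  · simp
  · intro x y _ _ hx hy
    rw [mul_add]
    exact add_mem hx hy
  · intro a x _ hx
    rw [MulOpposite.smul_eq_mul_unop, ← mul_assoc]
    exact RightIdeal.mul_mem _ hx _

theorem rmul_sup_le {I I' J : RightIdeal A} : rmul (I ⊔ I') J ≤ rmul I J ⊔ rmul I' J := by
  refine rmul_le.2 fun x hx j hj => ?_
  obtain ⟨y, hy, z, hz, rfl⟩ := Submodule.mem_sup.1 hx
  rw [add_mul]
  exact Submodule.add_mem_sup (mul_mem_rmul hy hj) (mul_mem_rmul hz hj)

/-- A proper right ideal `P` such that `a * b ∈ P` implies `a ∈ P` or `b ∈ P`. In a right invariant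
ring these are exactly the prime ideals. -/
def IsCompletelyPrime (P : RightIdeal A) : Prop :=
  P ≠ ⊤ ∧ ∀ a b : A, a * b ∈ P → a ∈ P ∨ b ∈ P

/-- `X` contains a finite product of completely prime right ideals that contain `I`. -/
def ContainsPrimeProduct (I X : RightIdeal A) : Prop :=
  ∃ l : List (RightIdeal A), (∀ P ∈ l, IsCompletelyPrime P ∧ I ≤ P) ∧ l.foldr rmul ⊤ ≤ X

namespace ContainsPrimeProduct

variable {I I' X Y : RightIdeal A}

theorem mono (h : ContainsPrimeProduct I X) (hXY : X ≤ Y) : ContainsPrimeProduct I Y := by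
  obtain ⟨l, hl, hX⟩ := h
  exact ⟨l, hl, hX.trans hXY⟩

theorem anti (h : ContainsPrimeProduct I X) (hI : I' ≤ I) : ContainsPrimeProduct I' X := by
  obtain ⟨l, hl, hX⟩ := h
  exact ⟨l, fun P hP => ⟨(hl P hP).1, hI.trans (hl P hP).2⟩, hX⟩

theorem top : ContainsPrimeProduct I ⊤ := ⟨[], by simp, le_top⟩

theorem of_prime (hP : IsCompletelyPrime X) (hI : I ≤ X) : ContainsPrimeProduct I X :=
  ⟨[X], by simp [hP, hI], rmul_le_left⟩

theorem foldr_append_le (l l' : List (RightIdeal A)) :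
    (l ++ l').foldr rmul ⊤ ≤ rmul (l.foldr rmul ⊤) (l'.foldr rmul ⊤) := by
  induction l with
  | nil =>
    intro x hx
    simpa using mul_mem_rmul (Submodule.mem_top (x := (1 : A))) hx
  | cons P l ih =>
    exact (rmul_mono le_rfl ih).trans le_rmul_assoc

theorem mul (hX : ContainsPrimeProduct I X)
    (hY : ContainsPrimeProduct I Y) : ContainsPrimeProduct I (rmul X Y) := by
  obtain ⟨l, hl, hX⟩ := hX
  obtain ⟨l', hl', hY⟩ := hY
  refine ⟨l ++ l', fun P hP => ?_, (foldr_append_le l l').trans (rmul_mono hX hY)⟩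
  rcases List.mem_append.1 hP with h | h
  exacts [hl P h, hl' P h]

theorem inf (hA : IsRightInvariant A) (hX : ContainsPrimeProduct I X)
    (hY : ContainsPrimeProduct I Y) : ContainsPrimeProduct I (X ⊓ Y) :=
  (hX.mul hY).mono (le_inf rmul_le_left (rmul_le_right hA))

end ContainsPrimeProduct

/-- If `K` is annihilated elementwise, modulo `I`, by products of primes, and `K` itself contains a
product of primes, then so does `I`. Either the right ideals `K Q + I`, where `Q` contains a product
of primes, have a least member, and then `K K Q ⊆ I` for the corresponding `Q`; or there is an
infinite independent sequence in some factor module of `A`. -/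
theorem ContainsPrimeProduct.of_elementwise (hA : IsRightInvariant A)
    (hfd : ∀ L : RightIdeal A, ¬ HasIndepSeqOver L) {I K : RightIdeal A} (hIK : I ≤ K)
    (hK : ContainsPrimeProduct I K) (ht : ∀ t ∈ K, ContainsPrimeProduct I (I.colon t)) :
    ContainsPrimeProduct I I := by
  by_cases hmin : ∃ Q₀, ContainsPrimeProduct I Q₀ ∧
      ∀ Q, ContainsPrimeProduct I Q → rmul K Q₀ ≤ rmul K Q ⊔ I
  · obtain ⟨Q₀, hQ₀, hmin⟩ := hmin
    refine (hK.mul (hK.mul hQ₀)).mono (rmul_le.2 fun t htK x hx => ?_)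
    have hle : rmul K (I.colon t) ⊔ I ≤ I.colon t :=
      sup_le (rmul_le_right hA) (I.le_colon hA t)
    exact hle (hmin _ (ht t htK) hx)
  · push Not at hmin
    exfalso
    obtain ⟨L, hL⟩ := exists_hasIndepSeqOver
      {p : RightIdeal A × RightIdeal A | I ≤ p.1 ∧ p.1 ≤ K ∧
        (∃ Q', ContainsPrimeProduct I Q' ∧ rmul p.1 Q' ≤ I) ∧
        ∃ Q, ContainsPrimeProduct I Q ∧ p.2 = rmul K Q ⊔ p.1}
      ⟨(I, rmul K ⊤ ⊔ I), le_rfl, hIK, ⟨⊤, .top, rmul_le_left⟩, ⊤, .top, rfl⟩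
      (by rintro ⟨a, b⟩ ⟨-, -, -, Q, -, hb⟩; exact hb.symm ▸ le_sup_right) (by
        rintro ⟨a, b⟩ ⟨hIa, haK, ⟨Q', hQ', haQ'⟩, Q, hQ, hb⟩
        dsimp only at hIa haK haQ' hb ⊢
        subst hb
        -- `K Q Q' + I` is not the least member, and multiplying by `Q'` moves `a` into `I`.
        obtain ⟨Q₁, hQ₁, hnot⟩ : ∃ Q₁, ContainsPrimeProduct I Q₁ ∧
            ¬ rmul K Q ≤ rmul K Q₁ ⊔ a := by
          by_contra! hcon
          obtain ⟨Q₁, hQ₁, hnot⟩ := hmin _ (hQ.mul hQ')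
          refine hnot (le_rmul_assoc.trans ((rmul_mono (hcon Q₁ hQ₁) le_rfl).trans
            (rmul_sup_le.trans (sup_le_sup rmul_le_left haQ'))))
        have hQ₂ := hQ.mul hQ₁
        have hnot' : ¬ rmul K Q ≤ rmul K (rmul Q Q₁) ⊔ a := fun h =>
          hnot (h.trans (sup_le_sup_right (rmul_mono le_rfl (rmul_le_right hA)) _))
        obtain ⟨e, he, he'⟩ := SetLike.not_le_iff_exists.1 hnot'
        have heK : e ∈ K := rmul_le_left he
        have hab : a ≤ (principal e ⊔ a) ⊓ (rmul K (rmul Q Q₁) ⊔ a) :=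
          le_inf le_sup_right le_sup_right
        have hdesc : rmul K (rmul Q Q₁) ⊔ (principal e ⊔ a) ⊓ (rmul K (rmul Q Q₁) ⊔ a) ≤
            rmul K (rmul Q Q₁) ⊔ a := sup_le le_sup_left inf_le_right
        refine ⟨principal e ⊔ a,
          ((principal e ⊔ a) ⊓ (rmul K (rmul Q Q₁) ⊔ a),
            rmul K (rmul Q Q₁) ⊔ (principal e ⊔ a) ⊓ (rmul K (rmul Q Q₁) ⊔ a)),
          ⟨hIa.trans hab, inf_le_left.trans (sup_le (principal_le.2 heK) haK),
            ⟨_, (ht e heK).mul hQ', ?_⟩, _, hQ₂, rfl⟩,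
          hab, ?_, sup_le (principal_le.2 (Submodule.mem_sup_left he)) le_sup_right, ?_, ?_⟩
        · refine (rmul_mono inf_le_left le_rfl).trans (rmul_sup_le.trans (sup_le ?_ ?_))
          · refine (rmul_mono le_rfl rmul_le_left).trans (rmul_le.2 ?_)
            rintro _ ⟨r, -, rfl⟩ q hq
            rw [leftMul_apply, mul_assoc]
            exact hA (I.colon e) r q hq
          · exact (rmul_mono le_rfl (rmul_le_right hA)).trans haQ'
        · exact hdesc.trans (sup_le_sup_right (rmul_mono le_rfl rmul_le_left) _)
        · exact fun h => he' (hdesc (h (Submodule.mem_sup_left (self_mem_principal e))))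
        · exact inf_le_inf_left _ hdesc)
    exact hfd L hL

end RightIdeals

/-! ### The torsion theory of prime-bounded right ideals -/

section Torsion

variable {A : Type u} [Ring A]

/-- Every right ideal `J'` above `J` contains a product of primes above `J'`. -/
def IsPrimeBounded (J : RightIdeal A) : Prop := ∀ J', J ≤ J' → ContainsPrimeProduct J' J'

namespace IsPrimeBounded

variable {I J K : RightIdeal A}

theorem mono (h : IsPrimeBounded J) (hJK : J ≤ K) : IsPrimeBounded K :=
  fun J' hJ' => h J' (hJK.trans hJ')

theorem top : IsPrimeBounded (⊤ : RightIdeal A) := fun J' hJ' => by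
  rw [top_le_iff.1 hJ']
  exact .top

/-- The prime-bounded right ideals form a Gabriel filter, i.e. the modules all of whose elements
have prime-bounded annihilators are closed under extensions. -/
theorem of_colon (hA : IsRightInvariant A) (hfd : ∀ L : RightIdeal A, ¬ HasIndepSeqOver L)
    (hK : IsPrimeBounded K) (h : ∀ s ∈ K, IsPrimeBounded (J.colon s)) : IsPrimeBounded J := by
  intro J' hJ'
  refine ContainsPrimeProduct.of_elementwise hA hfd (K := K ⊔ J') le_sup_right
    ((hK _ le_sup_left).anti le_sup_right) fun t ht => ?_
  obtain ⟨s, hs, j, hj, rfl⟩ := Submodule.mem_sup.1 ht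
  refine (h s hs _ fun r hr => ?_).anti (J'.le_colon hA _)
  rw [RightIdeal.mem_colon, add_mul]
  exact add_mem (hJ' hr) (J'.mul_mem hj r)

theorem inf (hA : IsRightInvariant A) (hfd : ∀ L : RightIdeal A, ¬ HasIndepSeqOver L)
    (hJ : IsPrimeBounded J) (hK : IsPrimeBounded K) : IsPrimeBounded (J ⊓ K) :=
  hJ.of_colon hA hfd fun s hs => hK.mono fun r hr => ⟨J.mul_mem hs r, hA K s r hr⟩

end IsPrimeBounded

/-- `J` is closed for the torsion theory of the Gabriel filter of prime-bounded right ideals: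
`A ⧸ J` is torsion-free. -/
def IsPrimeClosed (J : RightIdeal A) : Prop := ∀ t, IsPrimeBounded (J.colon t) → t ∈ J

/-- The closure of `J` for the torsion theory of the Gabriel filter of prime-bounded right
ideals: its image in `A ⧸ J` is the torsion submodule. -/
def primeClosure (hA : IsRightInvariant A) (hfd : ∀ L : RightIdeal A, ¬ HasIndepSeqOver L)
    (J : RightIdeal A) : RightIdeal A where
  carrier := {t | IsPrimeBounded (J.colon t)}
  zero_mem' := by
    change IsPrimeBounded (J.colon 0)
    rw [RightIdeal.colon_eq_top J.zero_mem]
    exact .top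
  add_mem' := by
    intro s t hs ht
    refine (hs.inf hA hfd ht).mono fun r hr => ?_
    rw [RightIdeal.mem_colon, add_mul]
    exact add_mem hr.1 hr.2
  smul_mem' := by
    intro c t ht
    change IsPrimeBounded (J.colon (t * c.unop))
    rw [RightIdeal.colon_mul]
    exact ht.mono (RightIdeal.le_colon hA _ _)

section Closure

variable (hA : IsRightInvariant A) (hfd : ∀ L : RightIdeal A, ¬ HasIndepSeqOver L)
  {J K : RightIdeal A}

theorem mem_primeClosure {t : A} : t ∈ primeClosure hA hfd J ↔ IsPrimeBounded (J.colon t) :=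
  Iff.rfl

theorem le_primeClosure : J ≤ primeClosure hA hfd J := fun t ht => by
  rw [mem_primeClosure, RightIdeal.colon_eq_top ht]
  exact .top

theorem isPrimeClosed_primeClosure : IsPrimeClosed (primeClosure hA hfd J) := fun t ht =>
  IsPrimeBounded.of_colon hA hfd ht fun s hs => by
    rw [← RightIdeal.colon_mul]
    exact hs

theorem primeClosure_le (hJK : J ≤ K) (hK : IsPrimeClosed K) : primeClosure hA hfd J ≤ K :=
  fun t ht => hK t (ht.mono (Submodule.comap_mono hJK))

theorem IsPrimeClosed.colon (hJ : IsPrimeClosed J) (t : A) : IsPrimeClosed (J.colon t) :=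
  fun s hs => hJ (t * s) (by rwa [RightIdeal.colon_mul])

theorem IsPrimeClosed.inf (hJ : IsPrimeClosed J) (hK : IsPrimeClosed K) :
    IsPrimeClosed (J ⊓ K) := fun t ht =>
  ⟨hJ t (ht.mono (Submodule.comap_mono inf_le_left)),
    hK t (ht.mono (Submodule.comap_mono inf_le_right))⟩

theorem isPrimeClosed_top : IsPrimeClosed (⊤ : RightIdeal A) := fun _ _ => trivial

theorem IsPrimeClosed.not_isPrimeBounded (hJ : IsPrimeClosed J) (h : J ≠ ⊤) :
    ¬ IsPrimeBounded J := fun hb =>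
  h (RightIdeal.eq_top_of_one_mem (hJ 1 (hb.mono fun r hr => by simpa using hr)))

end Closure

variable {J K : RightIdeal A}

/-- The descending chain condition on closed right ideals above `K`. -/
def ClosedDCC (K : RightIdeal A) : Prop :=
  ∀ N : ℕ → RightIdeal A, StrictAnti N → ¬ ∀ n, IsPrimeClosed (N n) ∧ K ≤ N n

theorem ClosedDCC.exists_minimal (h : ClosedDCC K)
    (S : Set (RightIdeal A)) (hS : ∀ J ∈ S, IsPrimeClosed J ∧ K ≤ J) (hne : S.Nonempty) :
    ∃ J ∈ S, ∀ J' ∈ S, J' ≤ J → J ≤ J' := by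
  by_contra! hcon
  choose! f hf hle hnot using hcon
  obtain ⟨J0, hJ0⟩ := hne
  have hmem : ∀ n, f^[n] J0 ∈ S := by
    intro n
    induction n with
    | zero => exact hJ0
    | succ n ih => rw [Function.iterate_succ_apply']; exact hf _ ih
  refine h (fun n => f^[n] J0) (strictAnti_nat_of_succ_lt fun n => ?_) fun n => hS _ (hmem n)
  rw [Function.iterate_succ_apply']
  exact lt_of_le_not_ge (hle _ (hmem n)) (hnot _ (hmem n))

/-- Under the descending chain condition on closed right ideals, every proper
closed right ideal lies below a closed prime: if `x` is minimal among the closed right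
ideals strictly above `J`, then `(J : c)`, for `c ∈ x` outside `J`, is maximal among proper closed
right ideals. -/
theorem ClosedDCC.exists_prime (hA : IsRightInvariant A)
    (hfd : ∀ L : RightIdeal A, ¬ HasIndepSeqOver L)
    (h : ClosedDCC K) (hJ : IsPrimeClosed J) (hKJ : K ≤ J)
    (hJt : J ≠ ⊤) : ∃ P, IsCompletelyPrime P ∧ IsPrimeClosed P ∧ J ≤ P := by
  obtain ⟨x, ⟨hx, hJx⟩, hmin⟩ := h.exists_minimal {x | IsPrimeClosed x ∧ J < x}
    (fun x hx => ⟨hx.1, hKJ.trans hx.2.le⟩) ⟨⊤, isPrimeClosed_top, hJt.lt_top⟩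
  obtain ⟨c, hcx, hcJ⟩ := SetLike.exists_of_lt hJx
  have hP : IsPrimeClosed (J.colon c) := hJ.colon c
  have hPt : J.colon c ≠ ⊤ := fun ht => hcJ (by
    have : (1 : A) ∈ J.colon c := ht ▸ trivial
    simpa using this)
  have hmax : ∀ X : RightIdeal A, J.colon c ≤ X → ¬ X ≤ J.colon c → IsPrimeBounded X := by
    intro X hX hXn
    obtain ⟨r, hrX, hr⟩ := SetLike.not_le_iff_exists.1 hXn
    let y := X.map (leftMul c) ⊔ J
    have hyx : y ≤ x := by
      refine sup_le ?_ hJx.le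
      rintro _ ⟨s, -, rfl⟩
      exact x.mul_mem hcx s
    have hlt : J < primeClosure hA hfd y := by
      refine lt_of_le_not_ge (le_sup_right.trans (le_primeClosure hA hfd)) fun hle => hr ?_
      exact hle (le_primeClosure hA hfd (Submodule.mem_sup_left ⟨r, hrX, rfl⟩))
    have hc : c ∈ primeClosure hA hfd y :=
      hmin _ ⟨isPrimeClosed_primeClosure hA hfd, hlt⟩ (primeClosure_le hA hfd hyx hx) hcx
    exact IsPrimeBounded.mono hc fun s hs => mem_of_leftMul_mem_sup le_rfl hX hs
  refine ⟨J.colon c, ⟨hPt, fun a b hab => ?_⟩, hP, J.le_colon hA c⟩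
  by_contra! hcon
  refine hP.not_isPrimeBounded hPt ?_
  have hb : ∀ a, a ∉ J.colon c → IsPrimeBounded (principal a ⊔ J.colon c) := fun a ha =>
    hmax _ le_sup_right fun hle => ha (hle (Submodule.mem_sup_left (self_mem_principal a)))
  refine (hb a hcon.1).of_colon hA hfd fun s hs => (hb b hcon.2).mono ?_
  obtain ⟨_, ⟨r, -, rfl⟩, p, hp, rfl⟩ := Submodule.mem_sup.1 hs
  refine sup_le (principal_le.2 ?_) (RightIdeal.le_colon hA _ _)
  rw [RightIdeal.mem_colon, add_mul]
  refine add_mem ?_ (RightIdeal.mul_mem _ hp b)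
  obtain ⟨r', hr'⟩ := mem_principal.1 (hA (principal b) r b (self_mem_principal b))
  rw [leftMul_apply, mul_assoc, ← hr', ← mul_assoc]
  exact RightIdeal.mul_mem _ hab r'

/-- Hopkins' theorem on the nilpotency of the radical, relative to the torsion theory: under the
descending chain condition on closed right ideals above the closed right ideal `K`, some product of
primes above `K` is contained in `K`. The role of a power of the radical that equals its square is
played by the least closed right ideal `W` above `K` that contains a product of primes; a minimal
closed `Z` with `Z W ⊈ K` then contradicts that `W` lies below all closed primes. -/
theorem ClosedDCC.containsPrimeProduct (hA : IsRightInvariant A)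
    (hfd : ∀ L : RightIdeal A, ¬ HasIndepSeqOver L)
    (h : ClosedDCC K) (hK : IsPrimeClosed K) :
    ContainsPrimeProduct K K := by
  obtain ⟨W, ⟨hWc, hKW, hW⟩, hWmin⟩ := h.exists_minimal
    {x | IsPrimeClosed x ∧ K ≤ x ∧ ContainsPrimeProduct K x} (fun x hx => ⟨hx.1, hx.2.1⟩)
    ⟨⊤, isPrimeClosed_top, le_top, .top⟩
  have hWle : ∀ X, IsPrimeClosed X → K ≤ X → ContainsPrimeProduct K X → W ≤ X := fun X h1 h2 h3 =>
    (hWmin (W ⊓ X) ⟨hWc.inf h1, le_inf hKW h2, hW.inf hA h3⟩ inf_le_left).trans inf_le_right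
  by_cases hWK : W ≤ K
  · exact hW.mono hWK
  exfalso
  obtain ⟨Z, ⟨hZc, hKZ, hZ⟩, hZmin⟩ := h.exists_minimal
    {x | IsPrimeClosed x ∧ K ≤ x ∧ ¬ rmul x W ≤ K} (fun x hx => ⟨hx.1, hx.2.1⟩)
    ⟨⊤, isPrimeClosed_top, le_top, fun hle => hWK fun w hw => by
      simpa using rmul_le.1 hle 1 trivial w hw⟩
  obtain ⟨z, hz, w, hw, hzw⟩ : ∃ z ∈ Z, ∃ w ∈ W, z * w ∉ K := by
    by_contra! hcon
    exact hZ (rmul_le.2 hcon)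
  -- `z W W` is not contained in `K`, since `W` is contained in the closure of `K + W W`.
  have hzWW : ¬ rmul (W.map (leftMul z) ⊔ K) W ≤ K := by
    intro hle
    have h1 : rmul W W ≤ K.colon z := rmul_le.2 fun w₁ h₁ w₂ h₂ => by
      rw [RightIdeal.mem_colon, ← mul_assoc]
      exact rmul_le.1 hle _ (Submodule.mem_sup_left ⟨w₁, h₁, rfl⟩) w₂ h₂
    exact hzw (hWle _ (hK.colon z) (K.le_colon hA z) ((hW.mul hW).mono h1) hw)
  have hZle : Z ≤ primeClosure hA hfd (W.map (leftMul z) ⊔ K) := by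
    refine hZmin _ ⟨isPrimeClosed_primeClosure hA hfd,
      le_sup_right.trans (le_primeClosure hA hfd), fun hle => hzWW
        ((rmul_mono (le_primeClosure hA hfd) le_rfl).trans hle)⟩ (primeClosure_le hA hfd ?_ hZc)
    refine sup_le ?_ hKZ
    rintro _ ⟨s, -, rfl⟩
    exact Z.mul_mem hz s
  have hbd : IsPrimeBounded (RightIdeal.colon (W.map (leftMul z) ⊔ K) z) := hZle hz
  obtain ⟨P, hP, hPc, hJP⟩ := h.exists_prime hA hfd (hK.colon z) (K.le_colon hA z) fun ht =>
    hzw (show w ∈ K.colon z from ht ▸ trivial)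
  have hKP : K ≤ P := (K.le_colon hA z).trans hJP
  exact hPc.not_isPrimeBounded hP.1 (hbd.mono fun s hs =>
    mem_of_leftMul_mem_sup (hWle P hPc hKP (.of_prime hP hKP)) hJP hs)

/-- In a right invariant ring with right Krull dimension every right ideal `B` contains a product of
primes above it. Otherwise consider the intervals `[x, y]` such that `(x : t)` is not prime-bounded
for some `t ∈ y`. One of them admits no infinite chain with factors of the same kind, and then the
closed right ideals above some `I` without a product of primes satisfy the descending chain
condition. So the closure of `I` contains a product of primes above it, hence so does `I`. -/
theorem containsPrimeProduct_of_not_noDeviation (hA : IsRightInvariant A)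
    (hfd : ∀ L : RightIdeal A, ¬ HasIndepSeqOver L)
    (hK : ¬ NoDeviation (⊥ : RightIdeal A) ⊤) (B : RightIdeal A) : ContainsPrimeProduct B B := by
  by_contra hB
  refine hK (NoDeviation.mono (a := B) (b := ⊤) ?_ bot_le le_top)
  refine NoDeviation.of_coinduction
    (fun x y => x ≤ y ∧ ∃ t ∈ y, ¬ IsPrimeBounded (x.colon t)) ?_
    ⟨le_top, 1, trivial, fun hbd => hB (hbd B fun r hr => by simpa using hr)⟩
  rintro x y ⟨hxy, t, hty, hbd⟩
  obtain ⟨I, hI, hIbd⟩ : ∃ I, x.colon t ≤ I ∧ ¬ ContainsPrimeProduct I I := by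
    simpa [IsPrimeBounded] using hbd
  -- The closed right ideals above `I` do not satisfy the descending chain condition.
  have hdcc : ¬ ClosedDCC I := fun hdcc => by
    have hcl : ClosedDCC (primeClosure hA hfd I) := fun N hN hN' =>
      hdcc N hN fun n => ⟨(hN' n).1, (le_primeClosure hA hfd).trans (hN' n).2⟩
    exact hIbd (ContainsPrimeProduct.of_elementwise hA hfd (le_primeClosure hA hfd)
      ((hcl.containsPrimeProduct hA hfd (isPrimeClosed_primeClosure hA hfd)).anti
        (le_primeClosure hA hfd))
      fun s hs => (hs _ le_rfl).anti (I.le_colon hA s))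
  obtain ⟨N, hN, hNI⟩ : ∃ N : ℕ → RightIdeal A, StrictAnti N ∧
      ∀ n, IsPrimeClosed (N n) ∧ I ≤ N n := by
    simpa [ClosedDCC] using hdcc
  have hcolon : ∀ n s, t * s ∈ (N n).map (leftMul t) ⊔ x → s ∈ N n := fun n s hs =>
    mem_of_leftMul_mem_sup le_rfl (hI.trans (hNI n).2) hs
  have hle : ∀ n, (N (n + 1)).map (leftMul t) ⊔ x ≤ (N n).map (leftMul t) ⊔ x := fun n =>
    sup_le_sup_right (Submodule.map_mono (hN (Nat.lt_succ_self n)).le) _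
  refine ⟨fun n => (N n).map (leftMul t) ⊔ x, strictAnti_nat_of_succ_lt fun n => ?_,
    fun n => ⟨le_sup_right, sup_le ?_ hxy⟩, fun n => ⟨hle n, ?_⟩⟩
  · obtain ⟨s, hs, hs'⟩ := SetLike.exists_of_lt (hN (Nat.lt_succ_self n))
    exact lt_of_le_not_ge (hle n) fun h' =>
      hs' (hcolon _ _ (h' (Submodule.mem_sup_left ⟨s, hs, rfl⟩)))
  · rintro _ ⟨s, -, rfl⟩
    exact y.mul_mem hty s
  · obtain ⟨s, hs, hs'⟩ := SetLike.exists_of_lt (hN (Nat.lt_succ_self n))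
    refine ⟨t * s, Submodule.mem_sup_left ⟨s, hs, rfl⟩, fun hb => ?_⟩
    refine hs' ((hNI (n + 1)).1 s (hb.mono fun r hr => ?_))
    rw [RightIdeal.mem_colon, mul_assoc] at hr
    exact hcolon _ _ hr

end Torsion

/-! ### Chains of primes and induction on primes -/

section Primes

variable {A : Type u} [Ring A]

/-- A set of primes without maximal elements: if `P < Q` are primes and `a ∈ Q` is outside `P`, then
the chain of the right ideals `a ^ n A + P` descends, and its factors contain copies of `A / Q`. -/
theorem noDeviation_of_primes_without_maximal (S : Set (RightIdeal A)) (hne : S.Nonempty)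
    (hS : ∀ P ∈ S, IsCompletelyPrime P) (hlt : ∀ P ∈ S, ∃ Q ∈ S, P < Q) :
    NoDeviation (⊥ : RightIdeal A) ⊤ := by
  obtain ⟨P₀, hP₀⟩ := hne
  refine NoDeviation.of_coinduction
    (fun x y => ∃ P ∈ S, ∃ φ : RightIdeal A → RightIdeal A, StrictMonoOn φ (Set.Ici P) ∧
      ∀ z, P ≤ z → x ≤ φ z ∧ φ z ≤ y) ?_
    ⟨P₀, hP₀, id, fun _ _ _ _ h => h, fun _ _ => ⟨bot_le, le_top⟩⟩
  rintro x y ⟨P, hP, φ, hφ, hxy⟩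
  obtain ⟨Q, hQ, hPQ⟩ := hlt P hP
  obtain ⟨a, haQ, haP⟩ := SetLike.exists_of_lt hPQ
  have hpow : ∀ n, a ^ n ∉ P := by
    intro n
    induction n with
    | zero => exact fun h => (hS P hP).1 (RightIdeal.eq_top_of_one_mem (by simpa using h))
    | succ n ih => exact fun h => ((hS P hP).2 _ _ (pow_succ a n ▸ h)).elim ih haP
  have hcolon : ∀ n, P.colon (a ^ n) ≤ P := fun n s hs =>
    ((hS P hP).2 _ _ hs).resolve_left (hpow n)
  have hψ : ∀ n, StrictMonoOn (fun z => φ (z.map (leftMul (a ^ n)) ⊔ P)) (Set.Ici Q) := by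
    intro n z hz w _ hzw
    refine hφ (Set.mem_Ici.2 le_sup_right) (Set.mem_Ici.2 le_sup_right) ?_
    obtain ⟨s, hs, hs'⟩ := SetLike.exists_of_lt hzw
    refine lt_of_le_not_ge (sup_le_sup_right (Submodule.map_mono hzw.le) _) fun hle => hs' ?_
    exact mem_of_leftMul_mem_sup le_rfl ((hcolon n).trans (hPQ.le.trans hz))
      (hle (Submodule.mem_sup_left ⟨s, hs, rfl⟩))
  have hφ' : ∀ z w, P ≤ z → z ≤ w → φ z ≤ φ w := fun z w hz hzw =>
    hφ.monotoneOn hz (hz.trans hzw) hzw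
  have hlow : ∀ n z, Q ≤ z →
      φ (principal (a ^ (n + 1)) ⊔ P) ≤ φ (z.map (leftMul (a ^ n)) ⊔ P) := by
    intro n z hz
    have hmem : a ^ (n + 1) ∈ z.map (leftMul (a ^ n)) := ⟨a, hz haQ, (pow_succ a n).symm⟩
    exact hφ' _ _ le_sup_right (sup_le_sup_right (principal_le.2 hmem) _)
  have hQt : Q < ⊤ := (hS Q hQ).1.lt_top
  refine ⟨fun n => φ (principal (a ^ n) ⊔ P), strictAnti_nat_of_succ_lt fun n =>
    (hlow n Q le_rfl).trans_lt (hψ n (Set.mem_Ici.2 le_rfl) (Set.mem_Ici.2 le_top) hQt),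
    fun n => hxy _ le_sup_right, fun n => ⟨Q, hQ, _, hψ n, fun z hz => ⟨hlow n z hz, ?_⟩⟩⟩
  exact hφ' _ _ le_sup_right (sup_le_sup_right (Submodule.map_mono le_top) _)

/-- If `y P₁ ⋯ Pₙ ⊆ x` and `y ⊈ x`, then some element of `y` outside `x` is annihilated modulo `x`
by one of the `Pᵢ`. -/
theorem exists_mul_prime_le (hA : IsRightInvariant A) (l : List (RightIdeal A))
    (x y : RightIdeal A) (hl : rmul y (l.foldr rmul ⊤) ≤ x) (hy : ¬ y ≤ x) :
    ∃ e ∈ y, e ∉ x ∧ ∃ P ∈ l, P ≤ x.colon e := by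
  induction l generalizing y with
  | nil => exact absurd (le_rmul_top.trans hl) hy
  | cons P l ih =>
    by_cases hP : rmul y P ≤ x
    · obtain ⟨e, he, he'⟩ := SetLike.not_le_iff_exists.1 hy
      exact ⟨e, he, he', P, by simp, fun p hp => rmul_le.1 hP e he p hp⟩
    · obtain ⟨e, he, he', P', hP', h⟩ := ih (rmul y P) ((rmul_assoc_le hA).trans hl) hP
      exact ⟨e, rmul_le_left he, he', P', by simp [hP'], h⟩

/-- If `B` contains a product of primes above `B` and the factors of `A` by these primes have
deviation, then so does `A / B`: each nonzero subquotient contains a nonzero homomorphic image of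
some `A / P`, so that Lemonnier's criterion applies. -/
theorem ContainsPrimeProduct.not_noDeviation (hA : IsRightInvariant A)
    (hfd : ∀ L : RightIdeal A, ¬ HasIndepSeqOver L) {B : RightIdeal A}
    (hB : ContainsPrimeProduct B B)
    (hP : ∀ P, IsCompletelyPrime P → B ≤ P → ¬ NoDeviation P ⊤) : ¬ NoDeviation B ⊤ := by
  intro hbad
  obtain ⟨l, hl, hlB⟩ := hB
  obtain ⟨L, hL⟩ := hbad.exists_hasIndepSeqOver fun x y hBx hxy _ => by
    obtain ⟨e, hey, hex, P, hPl, hPe⟩ := exists_mul_prime_le hA l x y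
      ((rmul_le_right hA).trans (hlB.trans hBx)) hxy.not_ge
    refine ⟨principal e ⊔ x, le_sup_right, sup_le (principal_le.2 hey) hxy.le,
      fun h => hex (h (Submodule.mem_sup_left (self_mem_principal e))), fun h =>
      hP P (hl P hPl).1 (hl P hPl).2 (h.map (f := fun z => z.colon e) ?_ hPe le_top)⟩
    rintro z ⟨hxz, -⟩ w ⟨-, hw⟩ hzw
    refine lt_of_le_not_ge (Submodule.comap_mono hzw.le) fun hle => hzw.not_ge fun s hs => ?_
    obtain ⟨_, ⟨r, -, rfl⟩, j, hj, rfl⟩ := Submodule.mem_sup.1 (hw hs)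
    have hjz := hxz hj
    have hjw := hzw.le hjz
    refine add_mem (hle ?_) hjz
    simpa using sub_mem hs hjw
  exact hfd L hL

/-- Noetherian induction on primes. If `A / B` has deviation for all `B` strictly above `P`, then so
does `A / P`, since the members of an infinite properly descending chain above `P` all lie strictly
above `P`; and such a `B` contains a product of primes that lie strictly above `P`. -/
theorem not_noDeviation_of_containsPrimeProduct (hA : IsRightInvariant A)
    (hfd : ∀ L : RightIdeal A, ¬ HasIndepSeqOver L)
    (hmax : ∀ S : Set (RightIdeal A), S.Nonempty → (∀ P ∈ S, IsCompletelyPrime P) →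
      ∃ P ∈ S, ∀ Q ∈ S, ¬ P < Q)
    (hprod : ∀ B : RightIdeal A, B ≠ ⊥ → B ≠ ⊤ → ContainsPrimeProduct B B) :
    ¬ NoDeviation (⊥ : RightIdeal A) ⊤ := by
  have key : ∀ P : RightIdeal A,
      (∀ Q, IsCompletelyPrime Q → P < Q → ¬ NoDeviation Q ⊤) → ¬ NoDeviation P ⊤ := by
    intro P ih hbad
    obtain ⟨N, hN, hPN, hbadN⟩ := hbad.exists_chain
    have hlt : P < N 1 := (hPN 2).1.trans_lt (hN (by norm_num))
    refine ContainsPrimeProduct.not_noDeviation hA hfd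
      (hprod (N 1) (bot_le.trans_lt hlt).ne' ((hN Nat.zero_lt_one).trans_le le_top).ne)
      (fun Q hQ hNQ => ih Q hQ (hlt.trans_le hNQ)) ((hbadN 0).mono le_rfl le_top)
  refine key ⊥ fun Q hQ _ hbad => ?_
  obtain ⟨P, ⟨hP, hPbad⟩, hPmax⟩ := hmax {P | IsCompletelyPrime P ∧ NoDeviation P ⊤}
    ⟨Q, hQ, hbad⟩ fun P hP => hP.1
  exact key P (fun Q' hQ' hlt hbad' => hPmax Q' ⟨hQ', hbad'⟩ hlt) hPbad

end Primes

/-! ### Two-sided ideals and factor rings -/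

section Quotient

variable {A : Type u} [Ring A]

/-- Independence of a sequence of submodules follows from a descending filtration `c` that separates
each term from all later ones. -/
theorem iSupIndep_of_antitone {R M : Type*} [Ring R] [AddCommGroup M] [Module R M]
    {N c : ℕ → Submodule R M} (hc : Antitone c) (hN : ∀ n, N n ≤ c n)
    (hd : ∀ n, N n ⊓ c (n + 1) ≤ ⊥) : iSupIndep N := by
  classical
  rw [iSupIndep_iff_finsetSum_eq_zero_imp_eq_zero]
  intro s v hv hsum
  by_contra! hcon
  obtain ⟨i, hi, hmin⟩ := (s.filter fun i => v i ≠ 0).exists_minimal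
    (by obtain ⟨i, hi, h⟩ := hcon; exact ⟨i, by simp [hi, h]⟩)
  obtain ⟨his, hi0⟩ := Finset.mem_filter.1 hi
  refine hi0 ((Submodule.mem_bot R).1 (hd i ⟨hv i his, ?_⟩))
  rw [← Finset.add_sum_erase s v his] at hsum
  rw [eq_neg_of_add_eq_zero_left hsum]
  refine neg_mem (sum_mem fun j hj => ?_)
  obtain ⟨hji, hjs⟩ := Finset.mem_erase.1 hj
  by_cases hj0 : v j = 0
  · rw [hj0]
    exact zero_mem _
  · have : i ≤ j := (le_total i j).elim id fun h => hmin (by simp [hjs, hj0]) h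
    exact hc (by omega : i + 1 ≤ j) (hN j (hv j hjs))

/-- The right ideal underlying a two-sided ideal. -/
def rightIdealOf (J : Ideal A) (hJ : J.IsTwoSided) : RightIdeal A where
  carrier := J
  add_mem' := J.add_mem
  zero_mem' := J.zero_mem
  smul_mem' c _ hx := hJ.mul_mem_of_left c.unop hx

theorem mem_rightIdealOf {J : Ideal A} {hJ : J.IsTwoSided} {x : A} :
    x ∈ rightIdealOf J hJ ↔ x ∈ J := Iff.rfl

/-- In a right invariant ring, a right ideal as a two-sided ideal. -/
def idealOf (hA : IsRightInvariant A) (J : RightIdeal A) : Ideal A where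
  carrier := J
  add_mem' := J.add_mem
  zero_mem' := J.zero_mem
  smul_mem' c _ hx := hA J c _ hx

theorem mem_idealOf {hA : IsRightInvariant A} {J : RightIdeal A} {x : A} :
    x ∈ idealOf hA J ↔ x ∈ J := Iff.rfl

theorem isTwoSided_idealOf (hA : IsRightInvariant A) (J : RightIdeal A) :
    (idealOf hA J).IsTwoSided := ⟨fun b hx => J.mul_mem hx b⟩

/-- In a right invariant ring, the prime ideals are the completely prime ones, because `a A b A`
is contained in `a b A`. -/
theorem isPrimeTwoSided_idealOf (hA : IsRightInvariant A) {P : RightIdeal A} :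
    IsPrimeTwoSided (idealOf hA P) ↔ IsCompletelyPrime P := by
  have htop : idealOf hA P = ⊤ ↔ P = ⊤ := by
    simp only [eq_top_iff, SetLike.le_def, mem_idealOf, Submodule.mem_top]
  constructor
  · rintro ⟨-, h1, h2⟩
    refine ⟨fun h => h1 (htop.2 h), fun a b hab => ?_⟩
    refine (h2 (idealOf hA (principal a)) (idealOf hA (principal b)) (isTwoSided_idealOf hA _)
      (isTwoSided_idealOf hA _) (Ideal.mul_le.2 ?_)).imp (fun h => h (self_mem_principal a))
      fun h => h (self_mem_principal b)
    rintro _ ⟨r, -, rfl⟩ _ ⟨r', -, rfl⟩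
    obtain ⟨s, hs⟩ := mem_principal.1 (hA (principal b) r b (self_mem_principal b))
    rw [mem_idealOf, leftMul_apply, leftMul_apply, mul_assoc, ← mul_assoc r, ← hs, mul_assoc,
      ← mul_assoc]
    exact P.mul_mem hab _
  · rintro ⟨h1, h2⟩
    refine ⟨isTwoSided_idealOf hA P, fun h => h1 (htop.1 h), fun I J _ _ hIJ => ?_⟩
    by_contra! hcon
    obtain ⟨i, hi, hi'⟩ := SetLike.not_le_iff_exists.1 hcon.1
    obtain ⟨j, hj, hj'⟩ := SetLike.not_le_iff_exists.1 hcon.2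
    exact (h2 i j (Ideal.mul_le.1 hIJ i hi j hj)).elim hi' hj'

/-- Products in the sense of left ideals and of right ideals agree. -/
theorem foldr_mul_idealOf (hA : IsRightInvariant A) (l : List (RightIdeal A)) :
    (l.map (idealOf hA)).foldr (fun I J => I * J) ⊤ = idealOf hA (l.foldr rmul ⊤) := by
  induction l with
  | nil => rfl
  | cons P l ih =>
    rw [List.map_cons, List.foldr_cons, List.foldr_cons, ih]
    refine le_antisymm (Ideal.mul_le.2 fun i hi j hj => mul_mem_rmul hi hj) ?_
    have htwo := isTwoSided_idealOf hA (l.foldr rmul ⊤)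
    have : rmul P (l.foldr rmul ⊤) ≤
        rightIdealOf (idealOf hA P * idealOf hA (l.foldr rmul ⊤)) inferInstance :=
      rmul_le.2 fun i hi j hj => Ideal.mul_mem_mul hi hj
    exact this

theorem containsPrimeProduct_iff (hA : IsRightInvariant A) (B : RightIdeal A) (hB : B ≠ ⊤) :
    ContainsPrimeProduct B B ↔ ∃ (n : ℕ) (P : Fin n → Ideal A), 0 < n ∧
      (∀ i, IsPrimeTwoSided (P i)) ∧ idealProd P ≤ idealOf hA B ∧ idealOf hA B ≤ ⨅ i, P i := by
  constructor
  · rintro ⟨l, hl, hlB⟩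
    refine ⟨l.length, fun i => idealOf hA (l.get i), ?_, fun i => ?_, ?_, le_iInf fun i => ?_⟩
    · refine List.length_pos_of_ne_nil ?_
      rintro rfl
      exact hB (top_le_iff.1 hlB)
    · exact (isPrimeTwoSided_idealOf hA).2 (hl _ (List.get_mem l i)).1
    · have : List.ofFn (fun i => idealOf hA (l.get i)) = l.map (idealOf hA) := by
        conv_rhs => rw [← List.ofFn_get l]
        rw [List.map_ofFn]
        rfl
      rw [idealProd, this, foldr_mul_idealOf]
      exact hlB
    · exact (hl _ (List.get_mem l i)).2
  · rintro ⟨n, P, -, hP, hPB, hBP⟩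
    let P' : Fin n → RightIdeal A := fun i => rightIdealOf (P i) (hP i).1
    have hP' : ∀ i, idealOf hA (P' i) = P i := fun i => rfl
    refine ⟨List.ofFn P', fun Q hQ => ?_, ?_⟩
    · obtain ⟨i, rfl⟩ := List.mem_ofFn.1 hQ
      exact ⟨(isPrimeTwoSided_idealOf hA).1 (hP i), (le_iInf_iff.1 hBP i : idealOf hA B ≤ P i)⟩
    · have h : (List.ofFn P').map (idealOf hA) = List.ofFn P := by
        rw [List.map_ofFn]
        rfl
      rw [idealProd, ← h, foldr_mul_idealOf] at hPB
      exact hPB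

theorem hasMaxConditionOnPrimes_iff (hA : IsRightInvariant A) :
    HasMaxConditionOnPrimes A ↔
      ∀ S : Set (RightIdeal A), S.Nonempty → (∀ P ∈ S, IsCompletelyPrime P) →
        ∃ P ∈ S, ∀ Q ∈ S, ¬ P < Q := by
  constructor
  · intro h S hne hS
    obtain ⟨_, ⟨P, hP, rfl⟩, hmax⟩ := h (idealOf hA '' S) (hne.image _) (by
      rintro _ ⟨P, hP, rfl⟩
      exact (isPrimeTwoSided_idealOf hA).2 (hS P hP))
    refine ⟨P, hP, fun Q hQ hlt => hlt.not_ge ?_⟩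
    have hle : idealOf hA P ≤ idealOf hA Q := hlt.le
    exact hmax ⟨Q, hQ, rfl⟩ hle
  · intro h S hne hS
    obtain ⟨P, hP, hmax⟩ := h {P | idealOf hA P ∈ S}
      (by obtain ⟨J, hJ⟩ := hne; exact ⟨rightIdealOf J (hS J hJ).1, hJ⟩)
      fun P hP => (isPrimeTwoSided_idealOf hA).1 (hS _ hP)
    refine ⟨idealOf hA P, hP, fun Q hQ hle => ?_⟩
    by_contra hnot
    exact hmax (rightIdealOf Q (hS Q hQ).1) hQ (lt_of_le_not_ge hle hnot)

section Transfer

variable (I : Ideal A) [I.IsTwoSided]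

/-- The preimage in `A` of a right ideal of `A ⧸ I`. -/
def comapQuotient (N : RightIdeal (A ⧸ I)) : RightIdeal A where
  carrier := {x | Ideal.Quotient.mk I x ∈ N}
  add_mem' hx hy := by simpa using add_mem hx hy
  zero_mem' := by simp
  smul_mem' c x hx := by
    change Ideal.Quotient.mk I (x * c.unop) ∈ N
    rw [map_mul]
    exact N.mul_mem hx _

/-- The image in `A ⧸ I` of a right ideal of `A`. -/
def mapQuotient (E : RightIdeal A) : RightIdeal (A ⧸ I) where
  carrier := Ideal.Quotient.mk I '' E
  add_mem' := by
    rintro _ _ ⟨x, hx, rfl⟩ ⟨y, hy, rfl⟩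
    exact ⟨x + y, add_mem hx hy, map_add _ _ _⟩
  zero_mem' := ⟨0, zero_mem E, map_zero _⟩
  smul_mem' := by
    rintro c _ ⟨x, hx, rfl⟩
    obtain ⟨c', hc'⟩ := Ideal.Quotient.mk_surjective c.unop
    refine ⟨x * c', E.mul_mem hx c', ?_⟩
    rw [map_mul, hc']
    rfl

theorem strictMono_comapQuotient : StrictMono (comapQuotient I) := by
  intro N N' h
  refine lt_of_le_not_ge (fun x hx => h.le hx) fun hle => h.not_ge fun x hx => ?_
  obtain ⟨y, rfl⟩ := Ideal.Quotient.mk_surjective x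
  exact hle (show y ∈ comapQuotient I N' from hx)

/-- Factor rings of a ring with right Krull dimension are right finite-dimensional. -/
theorem isRightFiniteDimensional_quotient (h : ¬ NoDeviation (⊥ : RightIdeal A) ⊤) :
    IsRightFiniteDimensional (A ⧸ I) := by
  rintro ⟨N, h0, hN⟩
  exact h ((noDeviation_of_iSupIndep hN h0).map ((strictMono_comapQuotient I).strictMonoOn _)
    bot_le le_top)

end Transfer

/-- If all factor rings are right finite-dimensional, there are no infinite sequences that are
independent modulo a right ideal. -/
theorem not_hasIndepSeqOver (hA : IsRightInvariant A)
    (h : ∀ (I : Ideal A) [I.IsTwoSided], IsRightFiniteDimensional (A ⧸ I)) (L : RightIdeal A) :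
    ¬ HasIndepSeqOver L := by
  rintro ⟨E, b, hb, hLb, hE, hEn, hinf⟩
  have htwo := isTwoSided_idealOf hA L
  have hker : ∀ x y : A, Ideal.Quotient.mk (idealOf hA L) x = Ideal.Quotient.mk _ y → x - y ∈ L :=
    fun x y hxy => Ideal.Quotient.eq.1 hxy
  refine h (idealOf hA L) ⟨fun n => mapQuotient _ (E n), fun n (h0 : mapQuotient _ (E n) = ⊥) => ?_,
    iSupIndep_of_antitone (c := fun n => mapQuotient _ (b n))
      (fun m n hmn => Set.image_mono (hb hmn)) (fun n => Set.image_mono (hE n)) fun n => ?_⟩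
  · refine hEn n fun x hx => hLb _ ?_
    have hx0 : Ideal.Quotient.mk (idealOf hA L) x ∈ mapQuotient (idealOf hA L) (E n) :=
      ⟨x, hx, rfl⟩
    rw [h0, Submodule.mem_bot] at hx0
    simpa using hker x 0 (by simpa using hx0)
  · rintro _ ⟨⟨x, hx, rfl⟩, ⟨y, hy, hxy⟩⟩
    have hyx := hLb (n + 1) (hker y x hxy)
    have hxL : x ∈ L := hinf n ⟨hx, by simpa using sub_mem hy hyx⟩
    exact (Submodule.mem_bot _).2 (Ideal.Quotient.eq_zero_iff_mem.2 hxL)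

end Quotient

theorem lemma10 (A : Type u) [Ring A] (hA : IsRightInvariant A) :
    HasRightKdim A ↔
      HasMaxConditionOnPrimes A ∧
      (∀ (I : Ideal A) [I.IsTwoSided], IsRightFiniteDimensional (A ⧸ I)) ∧
      (∀ B : Ideal A, B.IsTwoSided → B ≠ ⊥ → B ≠ ⊤ →
        ∃ (n : ℕ) (P : Fin n → Ideal A), 0 < n ∧ (∀ i, IsPrimeTwoSided (P i)) ∧
          idealProd P ≤ B ∧ B ≤ ⨅ i, P i) := by
  rw [HasRightKdim, hasKdim_iff, hasMaxConditionOnPrimes_iff hA]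
  constructor
  · intro h
    have hfd : ∀ (I : Ideal A) [I.IsTwoSided], IsRightFiniteDimensional (A ⧸ I) :=
      fun I _ => isRightFiniteDimensional_quotient I h
    refine ⟨fun S hne hS => ?_, hfd, fun B hB _ hBt => ?_⟩
    · by_contra! hcon
      exact h (noDeviation_of_primes_without_maximal S hne hS hcon)
    · refine (containsPrimeProduct_iff hA (rightIdealOf B hB) fun ht => hBt ?_).1
        (containsPrimeProduct_of_not_noDeviation hA (not_hasIndepSeqOver hA hfd) h _)
      exact (Ideal.eq_top_iff_one B).2 (mem_rightIdealOf.1 (ht ▸ Submodule.mem_top))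
  · rintro ⟨hmax, hfd, hprod⟩
    refine not_noDeviation_of_containsPrimeProduct hA (not_hasIndepSeqOver hA hfd) hmax
      fun B hB0 hBt => (containsPrimeProduct_iff hA B hBt).2 ?_
    refine hprod (idealOf hA B) (isTwoSided_idealOf hA B) (fun h0 => hB0 ?_) fun ht => hBt ?_
    · refine eq_bot_iff.2 fun x hx => ?_
      have : x ∈ idealOf hA B := hx
      rwa [h0] at this
    · refine RightIdeal.eq_top_of_one_mem ?_
      have : (1 : A) ∈ idealOf hA B := ht ▸ Submodule.mem_top
      exact this
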